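/- Model. A shared memory switch has $N$ output queues and a buffer of integer size $B$. Time is slotted, $t=0,1,2,\dots$, and the buffer is initially empty. In the arrival phase of slot $t$, an integer number $\tau(t)_i\in\{0,\dots,B\}$ of packets arrives to each queue $i$; the algorithm may then drop arbitrary (fractional) amounts of stored and newly arrived packets, so that the queue sizes $q_i\ge 0$ satisfy $\sum_i q_i\le B$. In the transmission phase each queue transmits $\min(q_i,1)$ and its size becomes $\max(q_i-1,0)$. A (deterministic) online algorithm is one whose decisions in slot $t$ depend only on the arrivals in slots $0,\dots,t$. For an instance $\tau$, $\mathrm{ALG}(\tau)$ is the total amount transmitted over all time, $\mathrm{OPT}(\tau)$ is the supremum of the total amount transmitted over all feasible (clairvoyant) ways of operating the buffer, and the competitive ratio of $\mathrm{ALG}$ is $\sup_\tau \mathrm{OPT}(\tau)/\mathrm{ALG}(\tau)$ over instances $\tau$ of finite duration (finitely many slots with arrivals). Fractional Longest Queue Drop, $\mathrm{LQD}^f$, accepts everything and, when the buffer overflows, cuts the longest queues down to a common level so that the total size is exactly $B$. Adversary. Let $a,h,n\ge 0$ be integers, $B=ah+\frac{h(h+1)}2$ and $N\ge n+a+h$ (queues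 numbered $0,\dots,N-1$). Against an online algorithm $\mathrm{ALG}$ the adversary plays in slots $0\le t<n$ as follows; no packets arrive in slots $t\ge n$. In slot $0$, queue $j$ receives $j$ packets for each $j<h$. In every slot $t<n$ there are exactly $a+1$ active queues, initially $h,\dots,h+a$; each active queue receives $B$ packets, and then an active queue that is shortest in the buffer of $\mathrm{ALG}$ after the arrival phase (ties broken arbitrarily) dies, i.e. receives no more packets; in the next slot it is replaced among the active queues by the new queue $h+a+t+1$. Theorem. (1) For all such $a,h,n,B,N$ and every online algorithm $\mathrm{ALG}$, an adversarial instance as above exists, and every such instance $\tau$ satisfies $\mathrm{ALG}(\tau)\le \mathrm{LQD}^f(\tau)$. Moreover, in each slot $t<n$ of $\tau$, after the arrival phase the queue that dies in slot $t$ has size exactly $M/(a+1)$ in the buffer of $\mathrm{LQD}^f$, where $M$ is $B$ minus the total size of the non-active queues of $\mathrm{LQD}^f$. (2) The competitive ratio of any online algorithm in the model with fractional packets and discrete time is at least $\sqrt2$, in the following sense. For every $c<\sqrt2$ there is $B_0$ such that for every $B\ge B_0$ there is $N_0$ such that for every $N\ge N_0$ every online algorithm for buffer size $B$ and $N$ queues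 has competitive ratio at least $c$. In particular, every online algorithm that is defined for all $B$ and $N$ has competitive ratio at least $\sqrt 2$, where the supremum of $\mathrm{OPT}(\tau)/\mathrm{ALG}(\tau)$ is taken over all $B$, all $N$ and all instances $\tau$ of finite duration. -/

import Mathlib

open scoped NNReal ENNReal

namespace SharedMemorySwitch

/-- An input instance for a shared memory switch with buffer size `B` and `N` output queues:
`τ t i` is the (integer) number of packets, between `0` and `B`, arriving to queue `i`
on the arrival phase of time slot `t`. -/
abbrev Instance (B N : ℕ) : Type := ℕ → Fin N → Fin (B + 1)

/-- No packets arrive after some time `T`. -/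
def HasFiniteDuration {B N : ℕ} (τ : Instance B N) : Prop :=
  ∃ T : ℕ, ∀ t, T < t → ∀ i, τ t i = 0

/-- A possible evolution of the buffer is recorded by the (fractional) sizes `q t i` of the queues
after the arrival phase of slot `t`. On the transmission phase the size becomes `max (q t i - 1) 0`
(subtraction on `ℝ≥0` is truncated at `0`). `residual q t` is the content of the buffer at
the beginning of slot `t`; the buffer is initially empty. -/
def residual {N : ℕ} (q : ℕ → Fin N → ℝ≥0) : ℕ → Fin N → ℝ≥0
  | 0 => fun _ => 0
  | t + 1 => fun i => q t i - 1

/-- On every arrival phase an arbitrary fraction of the stored and of the arriving packets may be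
dropped, and the total size of all queues must not exceed `B` afterwards. -/
def IsFeasible {B N : ℕ} (τ : Instance B N) (q : ℕ → Fin N → ℝ≥0) : Prop :=
  ∀ t, (∀ i, q t i ≤ residual q t i + ((τ t i : ℕ) : ℝ≥0)) ∧ ∑ i, q t i ≤ (B : ℝ≥0)

/-- The total amount transmitted over all time: queue `i` transmits `min (q t i) 1` in slot `t`. -/
noncomputable def transmitted {N : ℕ} (q : ℕ → Fin N → ℝ≥0) : ℝ≥0∞ :=
  ∑' t, ∑ i, ((min (q t i) 1 : ℝ≥0) : ℝ≥0∞)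

/-- The optimal offline (clairvoyant) value of an instance. -/
noncomputable def opt {B N : ℕ} (τ : Instance B N) : ℝ≥0∞ :=
  ⨆ (q : ℕ → Fin N → ℝ≥0) (_ : IsFeasible τ q), transmitted q

/-- A deterministic online algorithm with fractional packets, for buffer size `B` and `N` queues:
its state after the arrival phase of slot `t` depends only on the arrivals up to slot `t`. -/
structure OnlineAlgorithm (B N : ℕ) where
  /-- the queue sizes after each arrival phase -/
  run : Instance B N → ℕ → Fin N → ℝ≥0
  feasible : ∀ τ, IsFeasible τ (run τ)
  online : ∀ (τ τ' : Instance B N) (t : ℕ), (∀ s ≤ t, τ s = τ' s) → run τ t = run τ' t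

/-- The total amount transmitted by an online algorithm on an instance. -/
noncomputable def OnlineAlgorithm.value {B N : ℕ} (A : OnlineAlgorithm B N) (τ : Instance B N) :
    ℝ≥0∞ :=
  transmitted (A.run τ)

/-- The competitive ratio: the supremum of `OPT(τ) / ALG(τ)` over the instances of finite duration
(it is infinite if `ALG` transmits nothing on an instance on which `OPT` transmits something; an
instance on which both transmit nothing contributes `0 / 0 = 0`). -/
noncomputable def OnlineAlgorithm.competitiveRatio {B N : ℕ} (A : OnlineAlgorithm B N) : ℝ≥0∞ :=
  ⨆ (τ : Instance B N) (_ : HasFiniteDuration τ), opt τ / A.value τ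

/-- The push-out rule of fractional Longest Queue Drop applied to the virtual buffer content `v`:
if the buffer overflows, the longest queues are cut down to a common level, the largest one for
which the total size is at most `B`. -/
noncomputable def lqdCut {N : ℕ} (B : ℕ) (v : Fin N → ℝ≥0) : Fin N → ℝ≥0 :=
  if ∑ i, v i ≤ (B : ℝ≥0) then v
  else fun i => min (v i) (sSup {l : ℝ≥0 | ∑ j, min (v j) l ≤ (B : ℝ≥0)})

/-- The evolution of the buffer under fractional Longest Queue Drop. -/
noncomputable def lqdRun {B N : ℕ} (τ : Instance B N) : ℕ → Fin N → ℝ≥0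
  | 0 => lqdCut B fun i => ((τ 0 i : ℕ) : ℝ≥0)
  | t + 1 => lqdCut B fun i => (lqdRun τ t i - 1) + ((τ (t + 1) i : ℕ) : ℝ≥0)

theorem lqdCut_le {N : ℕ} (B : ℕ) (v : Fin N → ℝ≥0) (i : Fin N) : lqdCut B v i ≤ v i := by
  unfold lqdCut
  split_ifs
  · exact le_rfl
  · exact min_le_left _ _

theorem sum_lqdCut_le {N : ℕ} (B : ℕ) (v : Fin N → ℝ≥0) : ∑ i, lqdCut B v i ≤ (B : ℝ≥0) := by
  unfold lqdCut
  split_ifs with h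
  · exact h
  · have hc : IsClosed {l : ℝ≥0 | ∑ j, min (v j) l ≤ (B : ℝ≥0)} :=
      isClosed_le (by fun_prop) continuous_const
    have hne : {l : ℝ≥0 | ∑ j, min (v j) l ≤ (B : ℝ≥0)}.Nonempty := ⟨0, by simp⟩
    have hb : BddAbove {l : ℝ≥0 | ∑ j, min (v j) l ≤ (B : ℝ≥0)} := by
      refine ⟨∑ j, v j, fun l hl => ?_⟩
      by_contra hlt
      apply h
      refine le_trans (le_of_eq (Finset.sum_congr rfl fun j _ => ?_)) hl
      exact (min_eq_left ((Finset.single_le_sum (fun _ _ => zero_le) (Finset.mem_univ j)).trans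
        (not_le.mp hlt).le)).symm
    exact hc.csSup_mem hne hb

/-- Fractional Longest Queue Drop, as an online algorithm. -/
noncomputable def lqd (B N : ℕ) : OnlineAlgorithm B N where
  run := lqdRun
  feasible := by
    intro τ t
    cases t with
    | zero =>
      refine ⟨fun i => ?_, sum_lqdCut_le _ _⟩
      simpa [residual, lqdRun] using lqdCut_le B (fun i => ((τ 0 i : ℕ) : ℝ≥0)) i
    | succ t => exact ⟨fun i => lqdCut_le _ _ i, sum_lqdCut_le _ _⟩
  online := by
    intro τ τ' t
    induction t with
    | zero => intro h; simp only [lqdRun, h 0 le_rfl]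
    | succ t ih =>
      intro h
      simp only [lqdRun, h (t + 1) le_rfl, ih fun s hs => h s (Nat.le_succ_of_le hs)]

/-- The `a + 1` queues (given by their labels) that receive packets in slot `t`, when `d s` is the
label of the queue among them that dies in slot `s`: initially `h, …, h + a`; in each later slot
the queue that died is replaced by a new queue, with label `h + a + t` in slot `t`. -/
def activeQueues (a h : ℕ) (d : ℕ → ℕ) : ℕ → Finset ℕ
  | 0 => Finset.Icc h (h + a)
  | t + 1 => insert (h + a + (t + 1)) ((activeQueues a h d t).erase (d t))

/-- `τ` is what the adversary plays in `n` time slots against the online algorithm `A`. In slot `0`,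
queue `j` receives `j` packets for `j < h`. In each of the slots `t < n`, every one of the `a + 1`
active queues receives `B` packets, and then the shortest of these queues in the buffer of `A`
(ties broken arbitrarily) dies: it receives no more packets. -/
structure IsAdversarial {B N : ℕ} (A : OnlineAlgorithm B N) (a h n : ℕ) (τ : Instance B N)
    (d : ℕ → ℕ) : Prop where
  arrivals : ∀ (t : ℕ) (i : Fin N), (τ t i : ℕ) =
    if n ≤ t then 0
    else if (i : ℕ) ∈ activeQueues a h d t then B
    else if t = 0 ∧ (i : ℕ) < h then (i : ℕ)
    else 0
  dying_mem : ∀ t < n, d t ∈ activeQueues a h d t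
  shortest : ∀ t < n, ∀ i j : Fin N, (i : ℕ) = d t → (j : ℕ) ∈ activeQueues a h d t →
    A.run τ t i ≤ A.run τ t j

end SharedMemorySwitch

namespace SharedMemorySwitch

open Finset

/-! Follow `V`, the amount transmitted before slot `t`, and `Y`, the content of the queues that are
non-active in slot `t`. In one slot `V + Y` grows by at most `a + x`: the `a` surviving active
queues transmit at most 1 each, and the dying queue, of size `x`, passes into `V + Y`. Being the
shortest active queue, it satisfies `(a + 1) x + Y ≤ B`. The balanced state is `x = h`, `Y = 1 + ⋯ +
(h - 1)`, which exactly fills `B = a h + h (h + 1) / 2` and transmits `a + h` per slot.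

An algorithm may leave this state for a while, since a smaller `Y` allows a larger `x`. The
invariant `IsSchedule.sum_slotTransmission_add_min_le` therefore compares, for every horizon `l`,
the amount `V + ∑ min (q i) l` with its balanced value `t (a + h) + ∑ j < h, min j l`. For short
horizons the dying queue is limited by time, for long ones by `dying_bound`. Horizon 0 in slot `n -
1` bounds the throughput by `(n - 1) (a + h) + B`. Longest Queue Drop stays in the balanced state
(`IsSchedule.lqdRun_eq`) and attains this bound.

A clairvoyant strategy knows which queue dies: it keeps `H` packets there and a single packet in
each other active queue. This needs only `a + H (H + 1) / 2 ≤ B` and yields `a + H` per slot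
(`IsSchedule.le_opt`). With `a ≈ √(2B)`, `h ≈ (2 - √2) √B`, `H ≈ √(2B)`, the ratio `(a + H) / (a +
h)` tends to `√2`, and the final buffer content is negligible for large `n`. -/

theorem min_one_add_min_tsub (x l : ℝ≥0) : min x 1 + min (x - 1) l = min x (l + 1) := by
  rcases le_total x 1 with hx | hx
  · rw [tsub_eq_zero_of_le hx, min_eq_left hx, min_eq_left (hx.trans le_add_self)]
    simp
  · obtain ⟨y, rfl⟩ := exists_add_of_le hx
    rw [min_eq_right hx, add_tsub_cancel_left, ← min_add_add_left, add_comm l]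

theorem min_one_add_tsub (x : ℝ≥0) : min x 1 + (x - 1) = x := by
  rw [add_comm, tsub_add_min]

/-! ### Throughput slot by slot -/

/-- The amount transmitted in slot `t`. -/
noncomputable def slotTransmission {N : ℕ} (q : ℕ → Fin N → ℝ≥0) (t : ℕ) : ℝ≥0 :=
  ∑ i, min (q t i) 1

theorem transmitted_eq {N : ℕ} (q : ℕ → Fin N → ℝ≥0) :
    transmitted q = ∑' t, (slotTransmission q t : ℝ≥0∞) := by
  simp [transmitted, slotTransmission]

theorem le_transmitted {N : ℕ} (q : ℕ → Fin N → ℝ≥0) (T : ℕ) :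
    ((∑ t ∈ range T, slotTransmission q t : ℝ≥0) : ℝ≥0∞) ≤ transmitted q := by
  rw [transmitted_eq, ENNReal.ofNNReal_finsetSum]
  exact ENNReal.sum_le_tsum _

theorem transmitted_le {N : ℕ} {q : ℕ → Fin N → ℝ≥0} {c : ℝ≥0}
    (h : ∀ T, ∑ t ∈ range T, slotTransmission q t ≤ c) : transmitted q ≤ c := by
  rw [transmitted_eq, ENNReal.tsum_eq_iSup_nat]
  refine iSup_le fun T => ?_
  rw [← ENNReal.ofNNReal_finsetSum]
  exact_mod_cast h T

theorem sum_slotTransmission_add_le {N : ℕ} {q : ℕ → Fin N → ℝ≥0} {m : ℕ}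
    (h : ∀ t, m ≤ t → ∀ i, q (t + 1) i ≤ q t i - 1) (K : ℕ) :
    ∑ s ∈ range K, slotTransmission q (m + s) + ∑ i, q (m + K) i ≤ ∑ i, q m i := by
  induction K with
  | zero => simp
  | succ K ih =>
    refine le_trans ?_ ih
    rw [sum_range_succ, add_assoc, slotTransmission, ← sum_add_distrib]
    refine add_le_add le_rfl (sum_le_sum fun i _ => ?_)
    calc min (q (m + K) i) 1 + q (m + (K + 1)) i
        ≤ min (q (m + K) i) 1 + (q (m + K) i - 1) := add_le_add le_rfl (h (m + K) (by omega) i)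
      _ = q (m + K) i := min_one_add_tsub _

theorem sum_slotTransmission_add_eq {N : ℕ} {q : ℕ → Fin N → ℝ≥0} {m : ℕ}
    (h : ∀ t, m ≤ t → ∀ i, q (t + 1) i = q t i - 1) (K : ℕ) :
    ∑ s ∈ range K, slotTransmission q (m + s) + ∑ i, q (m + K) i = ∑ i, q m i := by
  induction K with
  | zero => simp
  | succ K ih =>
    rw [← ih, sum_range_succ, add_assoc, slotTransmission, ← sum_add_distrib]
    congr 1
    refine sum_congr rfl fun i _ => ?_
    rw [← add_assoc m, h (m + K) (by omega) i, min_one_add_tsub]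

/-- If nothing arrives after slot `m`, the transmissions before slot `m` and the content of the
buffer in slot `m` bound the total throughput. -/
theorem transmitted_le_of_no_arrivals {N : ℕ} {q : ℕ → Fin N → ℝ≥0} {m : ℕ}
    (h : ∀ t, m ≤ t → ∀ i, q (t + 1) i ≤ q t i - 1) :
    transmitted q ≤ (∑ t ∈ range m, slotTransmission q t + ∑ i, q m i : ℝ≥0) := by
  refine transmitted_le fun T => ?_
  refine le_trans (sum_le_sum_of_subset (range_subset_range.2 (Nat.le_add_left T m))) ?_
  rw [sum_range_add]
  exact add_le_add le_rfl (le_self_add.trans (sum_slotTransmission_add_le h T))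

/-- If nothing arrives and nothing is dropped after slot `m`, the content of the buffer in slot `m`
is transmitted completely. -/
theorem le_transmitted_of_no_drops {N : ℕ} {q : ℕ → Fin N → ℝ≥0} {m : ℕ}
    (h : ∀ t, m ≤ t → ∀ i, q (t + 1) i = q t i - 1) :
    ((∑ t ∈ range m, slotTransmission q t + ∑ i, q m i : ℝ≥0) : ℝ≥0∞) ≤ transmitted q := by
  obtain ⟨K, hK⟩ := exists_nat_ge (∑ i, q m i)
  refine le_trans ?_ (le_transmitted q (m + K))
  have hq : ∀ s i, q (m + s) i = q m i - s := by
    intro s i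
    induction s with
    | zero => simp
    | succ s ih => rw [← add_assoc, h _ (by omega), ih, tsub_tsub]; simp
  have h0 : ∑ i, q (m + K) i = 0 := by
    refine sum_eq_zero fun i _ => ?_
    rw [hq]
    exact tsub_eq_zero_of_le ((single_le_sum (fun _ _ => zero_le) (mem_univ i)).trans hK)
  have := sum_slotTransmission_add_eq h K
  rw [h0, add_zero] at this
  rw [sum_range_add, this]

/-! ### Active queues -/

theorem le_of_mem_activeQueues {a h : ℕ} {d : ℕ → ℕ} {t i : ℕ}
    (hi : i ∈ activeQueues a h d t) : i ≤ h + a + t := by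
  induction t with
  | zero => simp only [activeQueues, mem_Icc] at hi; omega
  | succ t ih =>
    simp only [activeQueues, mem_insert, mem_erase] at hi
    rcases hi with rfl | hi
    · omega
    · have := ih hi.2; omega

theorem card_activeQueues {a h : ℕ} {d : ℕ → ℕ} {t : ℕ}
    (hd : ∀ s < t, d s ∈ activeQueues a h d s) : (activeQueues a h d t).card = a + 1 := by
  induction t with
  | zero => simp only [activeQueues, Nat.card_Icc]; omega
  | succ t ih =>
    have hn : h + a + (t + 1) ∉ (activeQueues a h d t).erase (d t) := fun hm => by
      have := le_of_mem_activeQueues (mem_of_mem_erase hm); omega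
    rw [activeQueues, card_insert_of_notMem hn, card_erase_of_mem (hd t (by omega)),
      ih fun s hs => hd s (by omega)]
    rfl

theorem activeQueues_congr {a h : ℕ} {d d' : ℕ → ℕ} {t : ℕ} (hd : ∀ s < t, d s = d' s) :
    activeQueues a h d t = activeQueues a h d' t := by
  induction t with
  | zero => rfl
  | succ t ih =>
    rw [activeQueues, activeQueues, ih fun s hs => hd s (by omega), hd t (by omega)]

/-- The active queues as a set of queues of the switch. -/
def activeSet (N a h : ℕ) (d : ℕ → ℕ) (t : ℕ) : Finset (Fin N) :=
  univ.filter fun i => (i : ℕ) ∈ activeQueues a h d t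

theorem mem_activeSet {N a h : ℕ} {d : ℕ → ℕ} {t : ℕ} {i : Fin N} :
    i ∈ activeSet N a h d t ↔ (i : ℕ) ∈ activeQueues a h d t := by
  simp [activeSet]

theorem card_activeSet {N a h : ℕ} {d : ℕ → ℕ} {t : ℕ}
    (hd : ∀ s < t, d s ∈ activeQueues a h d s) (hN : h + a + t < N) :
    (activeSet N a h d t).card = a + 1 := by
  rw [← card_activeQueues hd, ← card_map Fin.valEmbedding]
  congr 1
  ext i
  simp only [mem_map, mem_activeSet, Fin.valEmbedding_apply]
  constructor
  · rintro ⟨j, hj, rfl⟩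
    exact hj
  · intro hi
    exact ⟨⟨i, by have := le_of_mem_activeQueues hi; omega⟩, hi, rfl⟩

/-! ### Arrival schedules and sums over active and non-active queues -/

/-- The arrivals of the adversary when queue `d t` dies in slot `t`. -/
structure IsSchedule {B N : ℕ} (a h n : ℕ) (τ : Instance B N) (d : ℕ → ℕ) : Prop where
  le_N : n + a + h ≤ N
  arrivals : ∀ (t : ℕ) (i : Fin N), (τ t i : ℕ) =
    if n ≤ t then 0
    else if (i : ℕ) ∈ activeQueues a h d t then B
    else if t = 0 ∧ (i : ℕ) < h then (i : ℕ)
    else 0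
  dying_mem : ∀ t < n, d t ∈ activeQueues a h d t

theorem IsAdversarial.isSchedule {B N a h n : ℕ} {A : OnlineAlgorithm B N} {τ : Instance B N}
    {d : ℕ → ℕ} (hA : IsAdversarial A a h n τ d) (hN : n + a + h ≤ N) :
    IsSchedule a h n τ d :=
  ⟨hN, hA.arrivals, hA.dying_mem⟩

namespace IsSchedule

variable {B N a h n : ℕ} {τ : Instance B N} {d : ℕ → ℕ}

theorem hasFiniteDuration (hS : IsSchedule a h n τ d) : HasFiniteDuration τ :=
  ⟨n, fun t ht i => Fin.ext (by rw [hS.arrivals, if_pos ht.le]; rfl)⟩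

theorem card_activeSet (hS : IsSchedule a h n τ d) {t : ℕ} (ht : t < n) :
    (activeSet N a h d t).card = a + 1 :=
  SharedMemorySwitch.card_activeSet (fun s hs => hS.dying_mem s (hs.trans ht))
    (by have := hS.le_N; omega)

theorem exists_dying (hS : IsSchedule a h n τ d) {t : ℕ} (ht : t < n) :
    ∃ δ : Fin N, (δ : ℕ) = d t ∧ δ ∈ activeSet N a h d t := by
  have hm := hS.dying_mem t ht
  have := le_of_mem_activeQueues hm
  exact ⟨⟨d t, by have := hS.le_N; omega⟩, rfl, mem_activeSet.2 hm⟩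

theorem arrivals_active (hS : IsSchedule a h n τ d) {t : ℕ} (ht : t < n) {i : Fin N}
    (hi : i ∈ activeSet N a h d t) : (τ t i : ℕ) = B := by
  rw [hS.arrivals, if_neg (by omega), if_pos (mem_activeSet.1 hi)]

theorem arrivals_succ (hS : IsSchedule a h n τ d) {t : ℕ} {i : Fin N}
    (hi : i ∉ activeSet N a h d (t + 1)) : (τ (t + 1) i : ℕ) = 0 := by
  rw [hS.arrivals, if_neg (mt mem_activeSet.2 hi)]
  simp

theorem arrivals_of_le (hS : IsSchedule a h n τ d) {t : ℕ} (ht : n ≤ t) (i : Fin N) :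
    (τ t i : ℕ) = 0 := by
  rw [hS.arrivals, if_pos ht]

theorem arrivals_future (hS : IsSchedule a h n τ d) {t : ℕ} {i : Fin N}
    (hi : h + a + t < i) : (τ t i : ℕ) = 0 := by
  rw [hS.arrivals, if_neg (fun hm => (le_of_mem_activeQueues hm).not_gt hi),
    if_neg (by omega : ¬(t = 0 ∧ (i : ℕ) < h)), ite_self]

theorem eq_zero_of_lt (hS : IsSchedule a h n τ d) {q : ℕ → Fin N → ℝ≥0} (hq : IsFeasible τ q)
    {t : ℕ} {i : Fin N} (hi : h + a + t < i) : q t i = 0 := by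
  have := (hq t).1 i
  rw [hS.arrivals_future hi] at this
  induction t with
  | zero => simpa [residual] using this
  | succ t ih =>
    have h0 : q t i = 0 :=
      ih (by omega) (by have := (hq t).1 i; rwa [hS.arrivals_future (by omega)] at this)
    simpa [residual, h0] using this

theorem succ_le (hS : IsSchedule a h n τ d) {q : ℕ → Fin N → ℝ≥0} (hq : IsFeasible τ q)
    {t : ℕ} {i : Fin N} (hi : n ≤ t + 1 ∨ i ∉ activeSet N a h d (t + 1)) :
    q (t + 1) i ≤ q t i - 1 := by
  have h0 : (τ (t + 1) i : ℕ) = 0 := hi.elim (fun h => hS.arrivals_of_le h i) hS.arrivals_succ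
  have := (hq (t + 1)).1 i
  rw [h0] at this
  simpa [residual] using this

/-- One queue joins the non-active ones in every slot. -/
theorem sum_compl_succ (hS : IsSchedule a h n τ d) {t : ℕ} (ht : t + 1 < n) {δ : Fin N}
    (hδ : (δ : ℕ) = d t) {f : Fin N → ℝ≥0} (hf : ∀ i : Fin N, h + a + t < i → f i = 0) :
    ∑ i ∈ (activeSet N a h d (t + 1))ᶜ, f i = ∑ i ∈ (activeSet N a h d t)ᶜ, f i + f δ := by
  have hN := hS.le_N
  let ν : Fin N := ⟨h + a + (t + 1), by omega⟩
  -- The newly active queue leaves the complement without changing the sum, because `f` vanishes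
  -- there.
  have hνf : f ν = 0 := hf ν (by simp only [ν]; omega)
  have hset : activeSet N a h d (t + 1) = insert ν ((activeSet N a h d t).erase δ) := by
    ext i
    simp only [mem_activeSet, activeQueues, mem_insert, mem_erase, Fin.ext_iff, ne_eq, hδ, ν]
  have hν : ν ∉ (activeSet N a h d t).erase δ := fun hm => by
    have := le_of_mem_activeQueues (mem_activeSet.1 (mem_of_mem_erase hm))
    simp only [ν] at this
    omega
  have hδm : δ ∈ activeSet N a h d t := mem_activeSet.2 (hδ ▸ hS.dying_mem t (by omega))
  have h1 := sum_compl_add_sum (activeSet N a h d (t + 1)) f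
  have h2 := sum_compl_add_sum (activeSet N a h d t) f
  have h3 : ∑ i ∈ activeSet N a h d (t + 1), f i = ∑ i ∈ (activeSet N a h d t).erase δ, f i := by
    rw [hset, sum_insert hν, hνf, zero_add]
  rw [← h2, h3, ← add_sum_erase _ f hδm, ← add_assoc] at h1
  exact add_right_cancel h1

theorem sum_split (hS : IsSchedule a h n τ d) {t : ℕ} (ht : t < n) {δ : Fin N}
    (hδ : (δ : ℕ) = d t) (f : Fin N → ℝ≥0) :
    ∑ i, f i = ∑ i ∈ (activeSet N a h d t)ᶜ, f i + f δ +
      ∑ i ∈ (activeSet N a h d t).erase δ, f i := by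
  have hδm : δ ∈ activeSet N a h d t := mem_activeSet.2 (hδ ▸ hS.dying_mem t ht)
  rw [← sum_compl_add_sum (activeSet N a h d t) f, ← add_sum_erase _ f hδm, add_assoc]

theorem card_erase (hS : IsSchedule a h n τ d) {t : ℕ} (ht : t < n) {δ : Fin N}
    (hδ : (δ : ℕ) = d t) : ((activeSet N a h d t).erase δ).card = a := by
  rw [card_erase_of_mem (mem_activeSet.2 (hδ ▸ hS.dying_mem t ht)), hS.card_activeSet ht]
  rfl

/-- The initial packets in the non-active queues. -/
theorem sum_compl_zero (hS : IsSchedule a h n τ d) (hn : 0 < n) (f : ℕ → ℝ≥0) (hf : f 0 = 0) :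
    ∑ i ∈ (activeSet N a h d 0)ᶜ, f (τ 0 i : ℕ) = ∑ j ∈ range h, f j := by
  have hN := hS.le_N
  have key : ∀ i : Fin N, (if i ∈ (activeSet N a h d 0)ᶜ then f (τ 0 i : ℕ) else 0) =
      (fun k : ℕ => if k < h then f k else 0) i := by
    intro i
    have hm : i ∈ activeSet N a h d 0 ↔ h ≤ (i : ℕ) ∧ (i : ℕ) ≤ h + a := by
      rw [mem_activeSet, activeQueues, mem_Icc]
    by_cases hi : i ∈ activeSet N a h d 0
    · rw [if_neg (by simpa using hi)]
      have := hm.1 hi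
      simp only
      rw [if_neg (by omega)]
    · rw [if_pos (mem_compl.2 hi), hS.arrivals, if_neg (by omega), if_neg (mt mem_activeSet.2 hi)]
      simp only [true_and]
      split_ifs
      · rfl
      · exact hf
  calc ∑ i ∈ (activeSet N a h d 0)ᶜ, f (τ 0 i : ℕ)
      = ∑ i : Fin N, if i ∈ (activeSet N a h d 0)ᶜ then f (τ 0 i : ℕ) else 0 := by
        rw [sum_ite_mem, univ_inter]
    _ = ∑ i : Fin N, (fun k : ℕ => if k < h then f k else 0) i := sum_congr rfl fun i _ => key i
    _ = ∑ k ∈ range N, if k < h then f k else 0 :=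
        Fin.sum_univ_eq_sum_range (fun k : ℕ => if k < h then f k else 0) N
    _ = ∑ k ∈ range h, if k < h then f k else 0 := by
        refine (sum_subset (range_subset_range.2 (by omega)) fun k _ hk => ?_).symm
        exact if_neg (by simpa using hk)
    _ = ∑ j ∈ range h, f j := sum_congr rfl fun k hk => if_pos (mem_range.1 hk)

end IsSchedule

/-! ### Upper bound on the throughput when the shortest active queue dies -/

/-- One more slot of horizon gains one unit from each of the sizes `l + 1, …, h - 1`. -/
theorem sum_range_min_succ (h l : ℕ) :
    ∑ j ∈ range h, min j (l + 1) = ∑ j ∈ range h, min j l + (h - 1 - l) := by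
  induction h with
  | zero => simp
  | succ h ih => rw [sum_range_succ, sum_range_succ, ih]; omega

theorem sum_range_min_of_le {h l : ℕ} (hl : h ≤ l + 1) :
    ∑ j ∈ range h, min j l = h * (h - 1) / 2 := by
  rw [← sum_range_id]
  exact sum_congr rfl fun j hj => min_eq_left (by have := mem_range.1 hj; omega)

theorem cast_half_mul_pred (h : ℕ) : ((h * (h - 1) / 2 : ℕ) : ℝ) = h * (h - 1) / 2 := by
  rw [Nat.cast_div (Nat.even_mul_pred_self h).two_dvd (by norm_num)]
  cases h <;> simp

theorem cast_half_mul_succ (h : ℕ) : ((h * (h + 1) / 2 : ℕ) : ℝ) = h * (h + 1) / 2 := by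
  rw [Nat.cast_div (Nat.even_mul_succ_self h).two_dvd (by norm_num)]
  simp

/-- With `V` the amount transmitted so far and `Y` the amount of the non-active queues, the size
`x` of a dying queue satisfies `(a + 1) x + Y ≤ B`; bounds on `V` and `V + Y` then bound
`V + Y + x`. -/
theorem dying_bound {a h B : ℕ} (hB : B ≤ a * h + h * (h + 1) / 2) {V Y x K : ℝ≥0}
    (hV : V ≤ K) (hY : V + Y ≤ K + (h * (h - 1) / 2 : ℕ)) (hx : Y + (a + 1) * x ≤ B) :
    V + Y + (a + x) ≤ K + (h * (h - 1) / 2 : ℕ) + (a + h) := by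
  have hB' : (B : ℝ) ≤ a * h + h * (h + 1) / 2 := by
    rw [← cast_half_mul_succ]; exact_mod_cast hB
  rw [← NNReal.coe_le_coe] at *
  push_cast [-Nat.cast_div_charZero] at *
  rw [cast_half_mul_pred] at *
  have ha : (0 : ℝ) ≤ a := Nat.cast_nonneg a
  have h1 := mul_le_mul_of_nonneg_left hY ha
  -- The left side is `V + a (V + Y) + (Y + (a + 1) x)`, and `a h + h (h + 1) / 2 = (a + 1) h + h (h
  -- - 1) / 2`.
  have h2 : ((a : ℝ) + 1) * (V + Y + x) ≤ (a + 1) * (K + h * (h - 1) / 2 + h) := by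
    linarith
  have := le_of_mul_le_mul_left h2 (by positivity)
  linarith

namespace IsSchedule

variable {B N a h n : ℕ} {τ : Instance B N} {d : ℕ → ℕ}

/-- The amount transmitted before slot `t`, together with what the queues non-active in slot `t`
can transmit in the `l` slots from `t` on, is at most what it would be if these queues had sizes
`1, …, h - 1` all the time. -/
theorem sum_slotTransmission_add_min_le (hS : IsSchedule a h n τ d)
    (hB : B ≤ a * h + h * (h + 1) / 2) {q : ℕ → Fin N → ℝ≥0} (hq : IsFeasible τ q)
    (hsh : ∀ t < n, ∀ i j : Fin N, (i : ℕ) = d t → j ∈ activeSet N a h d t → q t i ≤ q t j)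
    {t : ℕ} (ht : t < n) (l : ℕ) :
    ∑ s ∈ range t, slotTransmission q s + ∑ i ∈ (activeSet N a h d t)ᶜ, min (q t i) l ≤
      t * (a + h) + (∑ j ∈ range h, min j l : ℕ) := by
  induction t generalizing l with
  | zero =>
    have h0 := hS.sum_compl_zero ht (fun k : ℕ => min (k : ℝ≥0) l) (by simp)
    push_cast
    rw [← h0]
    simp only [range_zero, sum_empty, zero_add, zero_mul]
    gcongr with i _
    simpa [residual] using (hq 0).1 i
  | succ t ih =>
    have ht' : t < n := by omega
    obtain ⟨δ, hδ, hδm⟩ := hS.exists_dying ht'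
    have hact : ∑ i ∈ (activeSet N a h d t).erase δ, min (q t i) 1 ≤ a := by
      refine (sum_le_sum fun i _ => min_le_right (q t i) 1).trans (le_of_eq ?_)
      rw [sum_const, hS.card_erase ht' hδ, nsmul_eq_mul, mul_one]
    -- Slot `t` followed by a horizon of `l` slots is a horizon of `l + 1` slots starting in slot
    -- `t`; the dying queue now counts among the non-active ones.
    have hstep : ∑ s ∈ range (t + 1), slotTransmission q s +
          ∑ i ∈ (activeSet N a h d (t + 1))ᶜ, min (q (t + 1) i) l ≤
        ∑ s ∈ range t, slotTransmission q s +
          ∑ i ∈ (activeSet N a h d t)ᶜ, min (q t i) ((l + 1 : ℕ) : ℝ≥0) +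
            (a + min (q t δ) ((l + 1 : ℕ) : ℝ≥0)) := by
      calc _ ≤ ∑ s ∈ range (t + 1), slotTransmission q s +
          ∑ i ∈ (activeSet N a h d (t + 1))ᶜ, min (q t i - 1) (l : ℝ≥0) := by
            gcongr with i hi
            exact hS.succ_le hq (Or.inr (mem_compl.1 hi))
        _ = ∑ s ∈ range t, slotTransmission q s +
          (∑ i ∈ (activeSet N a h d t)ᶜ, (min (q t i) 1 + min (q t i - 1) (l : ℝ≥0)) +
            (∑ i ∈ (activeSet N a h d t).erase δ, min (q t i) 1 +
              (min (q t δ) 1 + min (q t δ - 1) (l : ℝ≥0)))) := by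
            rw [hS.sum_compl_succ ht hδ fun i hi => by
              rw [hS.eq_zero_of_lt hq hi]; simp, sum_range_succ, slotTransmission,
              hS.sum_split ht' hδ, sum_add_distrib]
            ring
        _ ≤ _ := by
            simp only [min_one_add_min_tsub, Nat.cast_add, Nat.cast_one]
            rw [add_assoc]
            gcongr
    refine hstep.trans ?_
    have hl := ih ht' (l + 1)
    rw [sum_range_min_succ] at hl
    rcases Nat.lt_or_ge l h with hlt | hge
    -- Short horizon: the dying queue contributes at most `l + 1`, and `(h - 1 - l) + (l + 1) = h`.
    · calc _ ≤ (t * (a + h) + ((∑ j ∈ range h, min j l + (h - 1 - l) : ℕ) : ℝ≥0)) +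
            (a + ((l + 1 : ℕ) : ℝ≥0)) := add_le_add hl (add_le_add le_rfl (min_le_right _ _))
        _ = _ := by
            obtain ⟨k, rfl⟩ := Nat.exists_eq_add_of_lt hlt
            rw [show l + k + 1 - 1 - l = k by omega]
            push_cast
            ring
    -- Long horizon: both balanced sums equal `h (h - 1) / 2`. The invariant at horizons `0` and `l
    -- + 1` bounds `V` and `V + Y`, with `Y` truncated at `l + 1`.
    · have h0 := ih ht' 0
      simp only [Nat.cast_zero, _root_.min_zero, sum_const_zero, add_zero] at h0
      rw [sum_range_min_of_le (by omega), show h - 1 - l = 0 by omega, add_zero] at hl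
      rw [sum_range_min_of_le (by omega)]
      refine (add_le_add le_rfl (add_le_add le_rfl (min_le_left _ _))).trans
        ((dying_bound hB h0 hl ?_).trans (le_of_eq ?_))
      · refine le_trans ?_ (hq t).2
        rw [← sum_compl_add_sum (activeSet N a h d t) (q t)]
        gcongr
        · exact min_le_left _ _
        · have := card_nsmul_le_sum (activeSet N a h d t) (q t) (q t δ)
            fun j hj => hsh t ht' δ j hδ hj
          rw [hS.card_activeSet ht', nsmul_eq_mul] at this
          exact_mod_cast this
      · push_cast
        ring

/-- An upper bound on the throughput of any way of operating the buffer in which dying queues are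
the shortest active ones. -/
theorem transmitted_le (hS : IsSchedule a h n τ d) (hn : 0 < n)
    (hB : B ≤ a * h + h * (h + 1) / 2) {q : ℕ → Fin N → ℝ≥0} (hq : IsFeasible τ q)
    (hsh : ∀ t < n, ∀ i j : Fin N, (i : ℕ) = d t → j ∈ activeSet N a h d t → q t i ≤ q t j) :
    transmitted q ≤ (((n - 1) * (a + h) + B : ℕ) : ℝ≥0) := by
  refine (transmitted_le_of_no_arrivals (m := n - 1)
    fun t ht i => hS.succ_le hq (Or.inl (by omega))).trans ?_
  have := hS.sum_slotTransmission_add_min_le hB hq hsh (t := n - 1) (by omega) 0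
  simp only [Nat.cast_zero, _root_.min_zero, sum_const_zero, add_zero] at this
  rw [ENNReal.coe_le_coe]
  push_cast
  exact add_le_add (by exact_mod_cast this) (hq (n - 1)).2

end IsSchedule

/-! ### Existence of adversarial instances -/

/-- The instance played by the adversary when queue `d t` dies in slot `t`. -/
def scheduleInstance {B : ℕ} (N a h n : ℕ) (hh : h ≤ B) (d : ℕ → ℕ) : Instance B N := fun t i =>
  ⟨if n ≤ t then 0
    else if (i : ℕ) ∈ activeQueues a h d t then B
    else if t = 0 ∧ (i : ℕ) < h then (i : ℕ)
    else 0, by split_ifs <;> omega⟩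

theorem scheduleInstance_congr {B N a h n : ℕ} (hh : h ≤ B) {d d' : ℕ → ℕ} {t : ℕ}
    (hd : ∀ s < t, d s = d' s) :
    scheduleInstance N a h n hh d t = scheduleInstance N a h n hh d' t := by
  funext i
  simp only [scheduleInstance, activeQueues_congr hd]

/-- The choice of the queue that dies in slot `m` affects arrivals only after slot `m`, so an online
algorithm's state in slot `m` is already determined when the choice is made. -/
theorem exists_isAdversarial {B N a h n : ℕ} (hh : h ≤ B) (hN : n + a + h ≤ N)
    (A : OnlineAlgorithm B N) :
    ∃ (τ : Instance B N) (d : ℕ → ℕ), IsAdversarial A a h n τ d := by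
  suffices H : ∀ m ≤ n, ∃ d : ℕ → ℕ, ∀ t < m, d t ∈ activeQueues a h d t ∧
      ∀ i j : Fin N, (i : ℕ) = d t → (j : ℕ) ∈ activeQueues a h d t →
        A.run (scheduleInstance N a h n hh d) t i ≤
          A.run (scheduleInstance N a h n hh d) t j by
    obtain ⟨d, hd⟩ := H n le_rfl
    exact ⟨scheduleInstance N a h n hh d, d, fun t i => rfl, fun t ht => (hd t ht).1,
      fun t ht => (hd t ht).2⟩
  intro m
  induction m with
  | zero => exact fun _ => ⟨0, fun t ht => absurd ht (Nat.not_lt_zero t)⟩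
  | succ m ih =>
    intro hm
    obtain ⟨d, hd⟩ := ih (by omega)
    have hcard := card_activeSet (N := N) (fun s hs => (hd s hs).1) (by omega : h + a + m < N)
    obtain ⟨δ, hδ, hmin⟩ := exists_min_image (activeSet N a h d m)
      (A.run (scheduleInstance N a h n hh d) m) (card_pos.1 (by omega))
    have hagree : ∀ s < m, d s = Function.update d m δ s := fun s hs =>
      (Function.update_of_ne (by omega) _ _).symm
    refine ⟨Function.update d m δ, fun t ht => ?_⟩
    have hact := activeQueues_congr (a := a) (h := h) (fun s hs => hagree s (by omega) : ∀ s < t, _)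
    have hrun : A.run (scheduleInstance N a h n hh d) t =
        A.run (scheduleInstance N a h n hh (Function.update d m δ)) t :=
      A.online _ _ t fun s hs => scheduleInstance_congr hh fun r hr => hagree r (by omega)
    rw [← hact, ← hrun]
    rcases Nat.lt_succ_iff_lt_or_eq.1 ht with hlt | rfl
    · rw [← hagree t hlt]
      exact hd t hlt
    · rw [Function.update_self]
      refine ⟨mem_activeSet.1 hδ, fun i j hi hj => ?_⟩
      rw [Fin.ext hi]
      exact hmin j (mem_activeSet.2 hj)

/-! ### Stationary strategies: the clairvoyant one and Longest Queue Drop -/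

/-- The evolution of the buffer when every dying queue has size `H`, every other active queue has
size `c`, the non-active queues start with sizes `q₀`, and no packet of a non-active queue is
dropped. -/
noncomputable def holdRun {N : ℕ} (a h n : ℕ) (d : ℕ → ℕ) (q₀ : Fin N → ℝ≥0) (H c : ℝ≥0) :
    ℕ → Fin N → ℝ≥0
  | 0 => fun i => if i ∈ activeSet N a h d 0 then (if (i : ℕ) = d 0 then H else c) else q₀ i
  | t + 1 => fun i =>
    if t + 1 < n ∧ i ∈ activeSet N a h d (t + 1) then (if (i : ℕ) = d (t + 1) then H else c)
    else holdRun a h n d q₀ H c t i - 1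

/-- The profile `0, …, H - 1` is stationary: every size drops by one, and the queue that died at
size `H` enters with `H - 1`. The identity expresses this through excesses over a level `k`. -/
theorem sum_range_tsub_succ (H k : ℕ) :
    ∑ j ∈ range H, (j - (k + 1)) + (H - 1 - k) = ∑ j ∈ range H, (j - k) := by
  induction H with
  | zero => simp
  | succ H ih => rw [sum_range_succ, sum_range_succ, ← ih]; omega

theorem half_mul_pred_add (h : ℕ) : h * (h - 1) / 2 + h = h * (h + 1) / 2 := by
  rw [← sum_range_id, ← sum_range_succ, sum_range_id, Nat.add_sub_cancel, mul_comm]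

/-- A cut at a level which fills the buffer is the cut of Longest Queue Drop. -/
theorem lqdCut_eq {N B : ℕ} {v w : Fin N → ℝ≥0} {L : ℝ≥0} (hw : ∀ i, w i = min (v i) L)
    (hsum : ∑ i, w i = B) : lqdCut B v = w := by
  have hle : ∀ i, w i ≤ lqdCut B v i := by
    intro i
    unfold lqdCut
    split_ifs with hv
    · exact (hw i).trans_le (min_le_left _ _)
    · rw [hw i]
      refine min_le_min le_rfl (le_csSup ?_ ?_)
      · refine ⟨∑ j, v j, fun l hl => ?_⟩
        by_contra hlt
        refine hv (le_trans (sum_le_sum fun j _ => ?_) hl)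
        exact le_min le_rfl
          ((single_le_sum (fun _ _ => zero_le) (mem_univ j)).trans (not_le.mp hlt).le)
      · rw [Set.mem_ofPred_eq, ← hsum]
        exact (sum_congr rfl fun i _ => (hw i).symm).le
  -- `w` lies pointwise below the cut but already has the largest admissible total, so they agree.
  have heq : ∑ i, w i = ∑ i, lqdCut B v i :=
    le_antisymm (sum_le_sum fun i _ => hle i) (hsum ▸ sum_lqdCut_le B v)
  funext i
  exact ((sum_eq_sum_iff_of_le fun i _ => hle i).1 heq i (mem_univ i)).symm

theorem lqdCut_of_sum_le {N B : ℕ} {v : Fin N → ℝ≥0} (hv : ∑ i, v i ≤ B) : lqdCut B v = v :=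
  if_pos hv

namespace IsSchedule

variable {B N a h n : ℕ} {τ : Instance B N} {d : ℕ → ℕ} {q₀ : Fin N → ℝ≥0} {H : ℕ} {c : ℝ≥0}

theorem holdRun_of_mem {t : ℕ} (ht : t < n) {i : Fin N} (hi : i ∈ activeSet N a h d t) :
    holdRun a h n d q₀ H c t i = if (i : ℕ) = d t then (H : ℝ≥0) else c := by
  cases t with
  | zero => exact if_pos hi
  | succ t => exact if_pos (And.intro ht hi)

theorem holdRun_zero {i : Fin N} (hi : i ∉ activeSet N a h d 0) :
    holdRun a h n d q₀ H c 0 i = q₀ i :=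
  if_neg hi

theorem holdRun_succ {t : ℕ} {i : Fin N} (hi : n ≤ t + 1 ∨ i ∉ activeSet N a h d (t + 1)) :
    holdRun a h n d q₀ H c (t + 1) i = holdRun a h n d q₀ H c t i - 1 :=
  if_neg fun hm => hi.elim (fun h => by omega) fun h => h hm.2

theorem holdRun_dying (hS : IsSchedule a h n τ d) {t : ℕ} (ht : t < n) {i : Fin N}
    (hi : (i : ℕ) = d t) : holdRun a h n d q₀ H c t i = H := by
  rw [holdRun_of_mem ht (mem_activeSet.2 (hi ▸ hS.dying_mem t ht)), if_pos hi]

theorem sum_erase_holdRun (hS : IsSchedule a h n τ d) {t : ℕ} (ht : t < n) {δ : Fin N}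
    (hδ : (δ : ℕ) = d t) (f : ℝ≥0 → ℝ≥0) :
    ∑ i ∈ (activeSet N a h d t).erase δ, f (holdRun a h n d q₀ H c t i) = a * f c := by
  have hc := hS.card_erase ht hδ
  refine (sum_eq_card_nsmul (b := f c) fun i hi => ?_).trans (by rw [hc, nsmul_eq_mul])
  rw [holdRun_of_mem ht (mem_of_mem_erase hi),
    if_neg fun hd => ne_of_mem_erase hi (Fin.ext (hd.trans hδ.symm))]

theorem holdRun_future (h₀ : ∀ i : Fin N, h + a < i → q₀ i = 0) {t : ℕ} {i : Fin N}
    (hi : h + a + t < i) : holdRun a h n d q₀ H c t i = 0 := by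
  have hm : i ∉ activeSet N a h d t := fun hm =>
    (le_of_mem_activeQueues (mem_activeSet.1 hm)).not_gt hi
  induction t with
  | zero => rw [holdRun_zero hm]; exact h₀ i hi
  | succ t ih =>
    rw [holdRun_succ (Or.inr hm), ih (by omega) fun hm' => by
      have := le_of_mem_activeQueues (mem_activeSet.1 hm')
      omega]
    simp

/-- The excesses over all levels `k` describe the distribution of the sizes without tracking labels;
a transmission turns level `k` into level `k + 1`. -/
theorem sum_compl_holdRun_succ (hS : IsSchedule a h n τ d)
    (h₀ : ∀ i : Fin N, h + a < i → q₀ i = 0) {t : ℕ} (ht : t + 1 < n) (k : ℕ) :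
    ∑ i ∈ (activeSet N a h d (t + 1))ᶜ, (holdRun a h n d q₀ H c (t + 1) i - k) =
      ∑ i ∈ (activeSet N a h d t)ᶜ, (holdRun a h n d q₀ H c t i - (k + 1 : ℕ)) +
        (H - 1 - k : ℕ) := by
  obtain ⟨δ, hδ, -⟩ := hS.exists_dying (t := t) (by omega)
  calc _ = ∑ i ∈ (activeSet N a h d (t + 1))ᶜ, (holdRun a h n d q₀ H c t i - (k + 1 : ℕ)) :=
        sum_congr rfl fun i hi => by
          rw [holdRun_succ (Or.inr (mem_compl.1 hi)), tsub_tsub, Nat.cast_succ, add_comm 1]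
    _ = _ := by
        rw [hS.sum_compl_succ ht hδ fun i hi => by rw [holdRun_future h₀ hi]; simp,
          hS.holdRun_dying (by omega) hδ]
        congr 1
        rw [← Nat.cast_tsub]
        congr 1
        omega

theorem sum_compl_holdRun_le (hS : IsSchedule a h n τ d)
    (h₀ : ∀ i : Fin N, h + a < i → q₀ i = 0)
    (hq₀ : ∀ k : ℕ, ∑ i ∈ (activeSet N a h d 0)ᶜ, (q₀ i - k) ≤ (∑ j ∈ range H, (j - k) : ℕ))
    {t : ℕ} (ht : t < n) (k : ℕ) :
    ∑ i ∈ (activeSet N a h d t)ᶜ, (holdRun a h n d q₀ H c t i - k) ≤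
      (∑ j ∈ range H, (j - k) : ℕ) := by
  induction t generalizing k with
  | zero =>
    refine le_trans (le_of_eq (sum_congr rfl fun i hi => ?_)) (hq₀ k)
    rw [holdRun_zero (mem_compl.1 hi)]
  | succ t ih =>
    rw [hS.sum_compl_holdRun_succ h₀ ht, ← sum_range_tsub_succ, Nat.cast_add (∑ j ∈ range H, (j - (k + 1)))]
    exact add_le_add (ih (by omega) (k + 1)) le_rfl

/-- Level `0` gives the total content of the non-active queues; level `H` shows that none of them
exceeds `H`. -/
theorem sum_compl_holdRun_eq (hS : IsSchedule a h n τ d)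
    (h₀ : ∀ i : Fin N, h + a < i → q₀ i = 0)
    (hq₀ : ∀ k : ℕ, ∑ i ∈ (activeSet N a h d 0)ᶜ, (q₀ i - k) = (∑ j ∈ range H, (j - k) : ℕ))
    {t : ℕ} (ht : t < n) (k : ℕ) :
    ∑ i ∈ (activeSet N a h d t)ᶜ, (holdRun a h n d q₀ H c t i - k) =
      (∑ j ∈ range H, (j - k) : ℕ) := by
  induction t generalizing k with
  | zero =>
    rw [← hq₀ k]
    refine sum_congr rfl fun i hi => ?_
    rw [holdRun_zero (mem_compl.1 hi)]
  | succ t ih =>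
    rw [hS.sum_compl_holdRun_succ h₀ ht, ← sum_range_tsub_succ, Nat.cast_add (∑ j ∈ range H, (j - (k + 1))),
      ih (by omega) (k + 1)]

theorem sum_holdRun (hS : IsSchedule a h n τ d) {t : ℕ} (ht : t < n) :
    ∑ i, holdRun a h n d q₀ H c t i =
      ∑ i ∈ (activeSet N a h d t)ᶜ, holdRun a h n d q₀ H c t i + H + a * c := by
  obtain ⟨δ, hδ, -⟩ := hS.exists_dying ht
  rw [hS.sum_split ht hδ, hS.holdRun_dying ht hδ, hS.sum_erase_holdRun ht hδ fun x => x]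

theorem sum_holdRun_le (hS : IsSchedule a h n τ d) (hn : 0 < n)
    (h₀ : ∀ i : Fin N, h + a < i → q₀ i = 0)
    (hq₀ : ∀ k : ℕ, ∑ i ∈ (activeSet N a h d 0)ᶜ, (q₀ i - k) ≤ (∑ j ∈ range H, (j - k) : ℕ))
    (hB : (H * (H + 1) / 2 : ℕ) + a * c ≤ B) (t : ℕ) :
    ∑ i, holdRun a h n d q₀ H c t i ≤ B := by
  by_cases ht : t < n
  · refine le_trans ?_ hB
    have := hS.sum_compl_holdRun_le (c := c) h₀ hq₀ ht 0
    simp only [Nat.cast_zero, tsub_zero, sum_range_id] at this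
    rw [hS.sum_holdRun ht, ← half_mul_pred_add, Nat.cast_add]
    gcongr
  · induction t with
    | zero => omega
    | succ t ih =>
      by_cases ht' : t < n
      · have := sum_holdRun_le hS hn h₀ hq₀ hB t
        refine le_trans (sum_le_sum fun i _ => ?_) this
        rw [holdRun_succ (Or.inl (by omega))]
        exact tsub_le_self
      · refine le_trans (sum_le_sum fun i _ => ?_) (ih ht')
        rw [holdRun_succ (Or.inl (by omega))]
        exact tsub_le_self

/-- In each slot the surviving active queues transmit `a` in all, by `1 ≤ c`, and the `H` packets of
the dying queue are either transmitted or become non-active content. -/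
theorem sum_slotTransmission_holdRun (hS : IsSchedule a h n τ d)
    (h₀ : ∀ i : Fin N, h + a < i → q₀ i = 0) (hc : 1 ≤ c) {t : ℕ} (ht : t < n) :
    ∑ s ∈ range t, slotTransmission (holdRun a h n d q₀ H c) s +
        ∑ i ∈ (activeSet N a h d t)ᶜ, holdRun a h n d q₀ H c t i =
      t * (a + H) + ∑ i ∈ (activeSet N a h d 0)ᶜ, q₀ i := by
  induction t with
  | zero =>
    simp only [range_zero, sum_empty, zero_add, Nat.cast_zero, zero_mul]
    exact sum_congr rfl fun i hi => by rw [holdRun_zero (mem_compl.1 hi)]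
  | succ t ih =>
    obtain ⟨δ, hδ, -⟩ := hS.exists_dying (t := t) (by omega)
    have hD : ∑ i ∈ (activeSet N a h d (t + 1))ᶜ, holdRun a h n d q₀ H c (t + 1) i =
        ∑ i ∈ (activeSet N a h d t)ᶜ, (holdRun a h n d q₀ H c t i - 1) + (H - 1) := by
      have := hS.sum_compl_holdRun_succ (c := c) (H := H) h₀ ht 0
      simpa using this
    have hT : slotTransmission (holdRun a h n d q₀ H c) t =
        ∑ i ∈ (activeSet N a h d t)ᶜ, min (holdRun a h n d q₀ H c t i) 1 + min (H : ℝ≥0) 1 + a := by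
      rw [slotTransmission, hS.sum_split (by omega) hδ, hS.holdRun_dying (by omega) hδ,
        hS.sum_erase_holdRun (by omega) hδ fun x => min x 1, min_eq_right hc, mul_one]
    calc _ = ∑ s ∈ range t, slotTransmission (holdRun a h n d q₀ H c) s +
          ∑ i ∈ (activeSet N a h d t)ᶜ, (min (holdRun a h n d q₀ H c t i) 1 +
            (holdRun a h n d q₀ H c t i - 1)) + (a + (min (H : ℝ≥0) 1 + (H - 1))) := by
          rw [sum_range_succ, hT, hD, sum_add_distrib]
          ring
      _ = _ := by
          simp only [min_one_add_tsub]
          rw [ih (by omega)]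
          push_cast
          ring

/-- The clairvoyant strategy which stores `H` packets in a queue when it dies. -/
theorem le_opt (hS : IsSchedule a h n τ d) (hn : 0 < n) (hH : H ≤ B) (hB1 : 1 ≤ B)
    (hB : a + H * (H + 1) / 2 ≤ B) : (((n - 1) * (a + H) : ℕ) : ℝ≥0∞) ≤ opt τ := by
  set q : ℕ → Fin N → ℝ≥0 := holdRun a h n d 0 H 1 with hqdef
  have hact : ∀ t < n, ∀ i ∈ activeSet N a h d t, q t i ≤ ((τ t i : ℕ) : ℝ≥0) := by
    intro t ht i hi
    rw [hqdef, holdRun_of_mem ht hi, hS.arrivals_active ht hi]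
    split_ifs
    · exact_mod_cast hH
    · exact_mod_cast hB1
  have hfeas : IsFeasible τ q := by
    intro t
    refine ⟨fun i => ?_, ?_⟩
    · cases t with
      | zero =>
        by_cases hi : i ∈ activeSet N a h d 0
        · exact (hact 0 hn i hi).trans le_add_self
        · simp [hqdef, holdRun, hi]
      | succ t =>
        by_cases hi : t + 1 < n ∧ i ∈ activeSet N a h d (t + 1)
        · exact (hact _ hi.1 i hi.2).trans le_add_self
        · rw [hqdef, holdRun_succ ((not_and_or.1 hi).imp_left not_lt.1)]
          exact le_self_add
    · refine hS.sum_holdRun_le hn (fun _ _ => rfl) (fun k => by simp) ?_ t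
      rw [mul_one, add_comm]
      exact_mod_cast hB
  refine le_trans ?_ (le_iSup₂_of_le q hfeas (le_transmitted_of_no_drops (m := n - 1)
    fun t ht i => holdRun_succ (Or.inl (by omega))))
  have h1 := hS.sum_slotTransmission_holdRun (q₀ := 0) (H := H) (c := 1) (fun _ _ => rfl) le_rfl
    (t := n - 1) (by omega)
  simp only [Pi.zero_apply, sum_const_zero, add_zero] at h1
  have h2 : (((n - 1) * (a + H) : ℕ) : ℝ≥0) ≤
      ∑ t ∈ range (n - 1), slotTransmission q t + ∑ i, q (n - 1) i := by
    rw [Nat.cast_mul, Nat.cast_add, ← h1]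
    gcongr
    exact subset_univ _
  exact_mod_cast h2

/-- On the instances of the adversary, Longest Queue Drop keeps all active queues at size `h`. -/
theorem lqdRun_eq (hS : IsSchedule a h n τ d) (hn : 0 < n) (hB : B = a * h + h * (h + 1) / 2) :
    lqdRun τ = holdRun a h n d (fun i => ((τ 0 i : ℕ) : ℝ≥0)) h h := by
  set q₀ : Fin N → ℝ≥0 := fun i => ((τ 0 i : ℕ) : ℝ≥0) with hq₀def
  have hhB : h ≤ B := by
    have := half_mul_pred_add h
    omega
  have h₀ : ∀ i : Fin N, h + a < i → q₀ i = 0 := fun i hi => by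
    rw [hq₀def]
    simp only
    rw [hS.arrivals_future (by omega), Nat.cast_zero]
  have hq₀ : ∀ k : ℕ, ∑ i ∈ (activeSet N a h d 0)ᶜ, (q₀ i - k) = (∑ j ∈ range h, (j - k) : ℕ) :=
    fun k => by
      rw [hS.sum_compl_zero hn (fun x : ℕ => (x : ℝ≥0) - k) (by simp), Nat.cast_sum]
      exact sum_congr rfl fun j _ => (Nat.cast_tsub j k).symm
  have hBc : ((h * (h + 1) / 2 : ℕ) : ℝ≥0) + a * h ≤ B := by
    rw [hB, add_comm]; push_cast; exact le_rfl
  -- Cutting at level `h` brings the overfull active queues down to `h`, leaves the non-active ones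
  -- untouched, as they have no excess over `h`, and fills the buffer exactly.
  have cut : ∀ t < n, ∀ v : Fin N → ℝ≥0, (∀ i ∈ activeSet N a h d t, (B : ℝ≥0) ≤ v i) →
      (∀ i ∉ activeSet N a h d t, v i = holdRun a h n d q₀ h h t i) →
      lqdCut B v = holdRun a h n d q₀ h h t := by
    intro t ht v hv hv'
    refine lqdCut_eq (L := h) (fun i => ?_) ?_
    · by_cases hi : i ∈ activeSet N a h d t
      · rw [holdRun_of_mem ht hi, ite_self, min_eq_right]
        exact le_trans (by exact_mod_cast hhB) (hv i hi)
      · rw [hv' i hi, min_eq_left]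
        have hz := hS.sum_compl_holdRun_eq (c := h) h₀ hq₀ ht h
        rw [sum_eq_zero (s := range h) fun j hj => by
          have := mem_range.1 hj
          omega, Nat.cast_zero, sum_eq_zero_iff] at hz
        exact tsub_eq_zero_iff_le.1 (hz i (mem_compl.2 hi))
    · have hz := hS.sum_compl_holdRun_eq (c := h) h₀ hq₀ ht 0
      simp only [Nat.cast_zero, tsub_zero, sum_range_id] at hz
      rw [hS.sum_holdRun ht, hz, hB, ← half_mul_pred_add]
      push_cast
      ring
  funext t
  induction t with
  | zero =>
    rw [lqdRun]
    refine cut 0 hn _ (fun i hi => ?_) fun i hi => ?_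
    · rw [hS.arrivals_active hn hi]
    · rw [holdRun_zero hi]
  | succ t ih =>
    rw [lqdRun, ih]
    by_cases ht : t + 1 < n
    · refine cut _ ht _ (fun i hi => ?_) fun i hi => ?_
      · rw [hS.arrivals_active ht hi]
        exact le_add_self
      · rw [hS.arrivals_succ hi, holdRun_succ (Or.inr hi), Nat.cast_zero, add_zero]
    · have hv : (fun i => holdRun a h n d q₀ h h t i - 1 + ((τ (t + 1) i : ℕ) : ℝ≥0)) =
          holdRun a h n d q₀ h h (t + 1) := by
        funext i
        rw [hS.arrivals_of_le (by omega), holdRun_succ (Or.inl (by omega)), Nat.cast_zero, add_zero]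
      rw [hv]
      exact lqdCut_of_sum_le (hS.sum_holdRun_le hn h₀ (fun k => (hq₀ k).le) hBc _)

/-- On the instances of the adversary, the sizes of the non-active queues of Longest Queue Drop add
up to `1 + ⋯ + (h - 1)`. -/
theorem sum_compl_lqdRun (hS : IsSchedule a h n τ d) (hB : B = a * h + h * (h + 1) / 2) {t : ℕ}
    (ht : t < n) :
    ∑ i ∈ (activeSet N a h d t)ᶜ, lqdRun τ t i = (h * (h - 1) / 2 : ℕ) := by
  have h₀ : ∀ i : Fin N, h + a < i → (fun i => ((τ 0 i : ℕ) : ℝ≥0)) i = 0 := fun i hi => by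
    simp only
    rw [hS.arrivals_future (by omega), Nat.cast_zero]
  have := hS.sum_compl_holdRun_eq (c := h) (H := h) h₀ (fun k => ?_) ht 0
  · simpa only [hS.lqdRun_eq (by omega) hB, Nat.cast_zero, tsub_zero, sum_range_id] using this
  · rw [hS.sum_compl_zero (by omega) (fun x : ℕ => (x : ℝ≥0) - k) (by simp), Nat.cast_sum]
    exact sum_congr rfl fun j _ => (Nat.cast_tsub j k).symm

theorem lqdRun_dying (hS : IsSchedule a h n τ d) (hB : B = a * h + h * (h + 1) / 2) {t : ℕ}
    (ht : t < n) {i : Fin N} (hi : (i : ℕ) = d t) : lqdRun τ t i = h := by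
  rw [hS.lqdRun_eq (by omega) hB, hS.holdRun_dying ht hi]

theorem le_transmitted_lqdRun (hS : IsSchedule a h n τ d) (hn : 0 < n)
    (hB : B = a * h + h * (h + 1) / 2) (hh : 0 < h) :
    (((n - 1) * (a + h) + B : ℕ) : ℝ≥0∞) ≤ transmitted (lqdRun τ) := by
  have h₀ : ∀ i : Fin N, h + a < i → (fun i => ((τ 0 i : ℕ) : ℝ≥0)) i = 0 := fun i hi => by
    simp only
    rw [hS.arrivals_future (by omega), Nat.cast_zero]
  have hrun := hS.lqdRun_eq hn hB
  have h0 := hS.sum_compl_lqdRun hB hn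
  have h1 := hS.sum_compl_lqdRun hB (t := n - 1) (by omega)
  have hT := hS.sum_slotTransmission_holdRun (H := h) (c := h) h₀ (by exact_mod_cast hh)
    (t := n - 1) (by omega)
  have hsum := hS.sum_holdRun (q₀ := fun i => ((τ 0 i : ℕ) : ℝ≥0)) (H := h) (c := h)
    (t := n - 1) (by omega)
  rw [← hrun] at hT hsum
  rw [h1] at hT hsum
  have h0' : ∑ i ∈ (activeSet N a h d 0)ᶜ, ((τ 0 i : ℕ) : ℝ≥0) = (h * (h - 1) / 2 : ℕ) := by
    rw [← h0]
    refine sum_congr rfl fun i hi => ?_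
    rw [hrun, holdRun_zero (mem_compl.1 hi)]
  rw [h0'] at hT
  refine le_trans (le_of_eq ?_) (le_transmitted_of_no_drops (m := n - 1) fun t ht i => ?_)
  · rw [add_right_cancel hT, hsum, ← ENNReal.coe_natCast, ENNReal.coe_inj]
    conv_lhs => rw [hB, ← half_mul_pred_add]
    push_cast
    ring
  · rw [hrun, holdRun_succ (Or.inl (by omega))]

end IsSchedule

/-! ### Degenerate cases and the comparison with Longest Queue Drop -/

theorem transmitted_eq_zero {N : ℕ} {q : ℕ → Fin N → ℝ≥0} (hq : ∀ t i, q t i = 0) :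
    transmitted q = 0 := by
  simp [transmitted, hq]

theorem IsFeasible.eq_zero {B N : ℕ} {τ : Instance B N} {q : ℕ → Fin N → ℝ≥0}
    (hq : IsFeasible τ q) (hB : B = 0) (t : ℕ) (i : Fin N) : q t i = 0 := by
  have h1 := (single_le_sum (f := q t) (fun _ _ => zero_le) (mem_univ i)).trans (hq t).2
  rw [hB, Nat.cast_zero] at h1
  exact le_antisymm h1 zero_le

theorem IsFeasible.eq_zero_of_arrivals {B N : ℕ} {τ : Instance B N} {q : ℕ → Fin N → ℝ≥0}
    (hq : IsFeasible τ q) (hτ : ∀ t i, (τ t i : ℕ) = 0) (t : ℕ) (i : Fin N) : q t i = 0 := by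
  have h1 := (hq t).1 i
  rw [hτ, Nat.cast_zero, add_zero] at h1
  induction t with
  | zero => exact le_antisymm h1 zero_le
  | succ t ih =>
    have h0 : q t i = 0 := ih (by simpa [hτ] using (hq t).1 i)
    simpa [residual, h0] using h1

namespace IsAdversarial

variable {B N a h n : ℕ} {A : OnlineAlgorithm B N} {τ : Instance B N} {d : ℕ → ℕ}

theorem value_le (hA : IsAdversarial A a h n τ d) (hN : n + a + h ≤ N) (hn : 0 < n)
    (hB : B ≤ a * h + h * (h + 1) / 2) : A.value τ ≤ (((n - 1) * (a + h) + B : ℕ) : ℝ≥0) :=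
  (hA.isSchedule hN).transmitted_le hn hB (A.feasible τ) fun t ht i j hi hj =>
    hA.shortest t ht i j hi (mem_activeSet.1 hj)

/-- Longest Queue Drop is optimal among online algorithms against the adversary. -/
theorem value_le_lqd (hA : IsAdversarial A a h n τ d) (hN : n + a + h ≤ N)
    (hB : B = a * h + h * (h + 1) / 2) : A.value τ ≤ (lqd B N).value τ := by
  have hS := hA.isSchedule hN
  rcases Nat.eq_zero_or_pos n with hn | hn
  · refine (transmitted_eq_zero ((A.feasible τ).eq_zero_of_arrivals fun t i => ?_)).trans_le zero_le
    exact hS.arrivals_of_le (by omega) i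
  -- If `h = 0` then `B = 0`. Otherwise the active queues of Longest Queue Drop, of size `h ≥ 1`,
  -- transmit a full unit each.
  rcases Nat.eq_zero_or_pos h with hh | hh
  · refine (transmitted_eq_zero ((A.feasible τ).eq_zero ?_)).trans_le zero_le
    simp [hB, hh]
  · refine (hA.value_le hN hn hB.le).trans ?_
    exact_mod_cast hS.le_transmitted_lqdRun hn hB hh

theorem lqd_dying (hA : IsAdversarial A a h n τ d) (hN : n + a + h ≤ N)
    (hB : B = a * h + h * (h + 1) / 2) {t : ℕ} (ht : t < n) {i : Fin N} (hi : (i : ℕ) = d t) :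
    ((lqd B N).run τ t i : ℝ) =
      ((B : ℝ) - ∑ j with ((j : Fin N) : ℕ) ∉ activeQueues a h d t,
        ((lqd B N).run τ t j : ℝ)) / ((a : ℝ) + 1) := by
  have hS := hA.isSchedule hN
  have hfilter : (univ.filter fun j : Fin N => (j : ℕ) ∉ activeQueues a h d t) =
      (activeSet N a h d t)ᶜ := by
    ext j
    simp [mem_activeSet]
  have hx : (lqd B N).run τ t i = h := hS.lqdRun_dying hB ht hi
  have hD : ∑ j ∈ (activeSet N a h d t)ᶜ, (lqd B N).run τ t j = (h * (h - 1) / 2 : ℕ) :=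
    hS.sum_compl_lqdRun hB ht
  rw [hfilter, hx, ← NNReal.coe_sum, hD, eq_div_iff (by positivity), NNReal.coe_natCast,
    NNReal.coe_natCast, cast_half_mul_pred, hB, Nat.cast_add, cast_half_mul_succ]
  push_cast
  ring

end IsAdversarial

/-! ### The lower bound `√2` -/

/-- Parameters of the adversary for which the clairvoyant strategy gains a factor `c`. -/
theorem exists_parameters {c : ℝ} (hc : c < √2) : ∃ B₀ : ℕ, ∀ B ≥ B₀, ∃ a h H : ℕ,
    h ≤ B ∧ H ≤ B ∧ 1 ≤ B ∧ B ≤ a * h + h * (h + 1) / 2 ∧ a + H * (H + 1) / 2 ≤ B ∧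
      c * (a + h) < a + H := by
  set r := √2 with hr
  have hr2 : r * r = 2 := Real.mul_self_sqrt (by norm_num)
  have hr1 : 1.4 < r := by
    rw [hr]; exact Real.lt_sqrt_of_sq_lt (by norm_num)
  have hr1' : r < 1.5 := by
    rw [hr, Real.sqrt_lt' (by norm_num)]; norm_num
  -- With `s = √B`, rounding gives `a + h ≤ 2 s + 2` and `a + H > 2 r s - 3`, so the gain requires
  -- `2 s (r - c) > 2 |c| + 3`.
  obtain ⟨S, hS⟩ := exists_nat_ge (max 10 ((2 * |c| + 3) / (2 * (r - c)) + 1))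
  have hS10 : (10 : ℝ) ≤ S := (le_max_left _ _).trans hS
  have hSc : (2 * |c| + 3) / (2 * (r - c)) < S := by
    have := (le_max_right (10 : ℝ) _).trans hS
    linarith
  refine ⟨S ^ 2, fun B hB => ?_⟩
  obtain ⟨s, hs0, hs⟩ : ∃ s : ℝ, 0 ≤ s ∧ s * s = B :=
    ⟨√B, Real.sqrt_nonneg _, Real.mul_self_sqrt (Nat.cast_nonneg B)⟩
  have hsS : (S : ℝ) ≤ s := by
    refine abs_le_of_sq_le_sq' ?_ hs0 |>.2
    rw [sq s, hs]
    exact_mod_cast hB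
  have hs10 : 10 ≤ s := hS10.trans hsS
  have ha1 := Nat.le_ceil (r * s)
  have ha2 := Nat.ceil_lt_add_one (show 0 ≤ r * s by positivity)
  have hh1 := Nat.le_ceil ((2 - r) * s)
  have hh2 := Nat.ceil_lt_add_one (show 0 ≤ (2 - r) * s from mul_nonneg (by linarith) hs0)
  have hH0 : 0 ≤ r * s - 2 := by nlinarith
  have hH1 := Nat.floor_le hH0
  have hH2 := Nat.lt_floor_add_one (r * s - 2)
  -- The 2 subtracted in `H` makes room for `a`: `(r s - 2) (r s - 1) / 2 = B - 3 r s / 2 + 1`,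
  -- while `a < r s + 1`.
  refine ⟨⌈r * s⌉₊, ⌈(2 - r) * s⌉₊, ⌊r * s - 2⌋₊, ?_⟩
  generalize ⌈r * s⌉₊ = a at *
  generalize ⌈(2 - r) * s⌉₊ = h at *
  generalize ⌊r * s - 2⌋₊ = H at *
  have hB1 : (h : ℝ) ≤ B := by nlinarith
  have hB2 : (H : ℝ) ≤ B := by nlinarith
  have hB3 : (1 : ℝ) ≤ B := by nlinarith
  refine ⟨by exact_mod_cast hB1, by exact_mod_cast hB2, by exact_mod_cast hB3, ?_, ?_, ?_⟩
  · have h0 : (0 : ℝ) ≤ h := Nat.cast_nonneg h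
    have h1 : r * s * ((2 - r) * s) ≤ a * h :=
      mul_le_mul ha1 hh1 (mul_nonneg (by linarith) hs0) (Nat.cast_nonneg a)
    have h2 : (2 - r) * s * ((2 - r) * s) ≤ h * h :=
      mul_le_mul hh1 hh1 (mul_nonneg (by linarith) hs0) h0
    have h3 : (B : ℝ) ≤ a * h + h * (h + 1) / 2 := by
      have e : r * s * ((2 - r) * s) + (2 - r) * s * ((2 - r) * s) / 2 = B := by
        linear_combination (-(1 / 2) * s * s) * hr2 + hs
      linarith
    rw [← cast_half_mul_succ] at h3
    exact_mod_cast h3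
  · have h1 : (H : ℝ) * (H + 1) ≤ (r * s - 2) * (r * s - 2 + 1) :=
      mul_le_mul hH1 (by linarith) (by positivity) hH0
    have h3 : (a : ℝ) + H * (H + 1) / 2 ≤ B := by
      have e : (r * s - 2) * (r * s - 2 + 1) = 2 * B - 3 * (r * s) + 2 := by
        linear_combination s * s * hr2 + 2 * hs
      have : 14 ≤ r * s := by nlinarith
      linarith
    rw [← cast_half_mul_succ] at h3
    exact_mod_cast h3
  · have hrc : 0 < r - c := by linarith
    rw [div_lt_iff₀ (by positivity)] at hSc
    have h1 : (S : ℝ) * (2 * (r - c)) ≤ s * (2 * (r - c)) := by gcongr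
    have h2 : c * (a + h) ≤ 2 * c * s + 2 * |c| := by
      have e : (a : ℝ) + h - 2 * s ≤ 2 := by linarith
      have e0 : (0 : ℝ) ≤ a + h - 2 * s := by linarith
      have : c * (a + h - 2 * s) ≤ |c| * 2 :=
        (mul_le_mul_of_nonneg_right (le_abs_self c) e0).trans
          (mul_le_mul_of_nonneg_left e (abs_nonneg c))
      linarith
    linarith

theorem le_competitiveRatio {c : ℝ} (hc : c < √2) : ∃ B₀ : ℕ, ∀ B ≥ B₀, ∃ N₀ : ℕ, ∀ N ≥ N₀,
    ∀ A : OnlineAlgorithm B N, ENNReal.ofReal c ≤ A.competitiveRatio := by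
  wlog hc0 : 0 ≤ c generalizing c
  · obtain ⟨B₀, hB₀⟩ := this (c := 0) (by positivity) le_rfl
    refine ⟨B₀, fun B hB => ?_⟩
    obtain ⟨N₀, hN₀⟩ := hB₀ B hB
    refine ⟨N₀, fun N hN A => le_trans ?_ (hN₀ N hN A)⟩
    exact ENNReal.ofReal_le_ofReal (not_le.1 hc0).le
  obtain ⟨B₀, hB₀⟩ := exists_parameters hc
  refine ⟨B₀, fun B hB => ?_⟩
  obtain ⟨a, h, H, hhB, hHB, hB1, hBu, hBl, hgain⟩ := hB₀ B hB
  -- After `m` slots the accumulated gain `m (a + H - c (a + h))` covers `c B`, the weight of the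
  -- final buffer content. The extra slot in `n - 1 = m + 1` keeps `opt τ` positive even if `m = 0`.
  obtain ⟨m, hm⟩ := exists_nat_ge (c * B / (a + H - c * (a + h)))
  rw [div_le_iff₀ (by linarith)] at hm
  refine ⟨m + 1 + 1 + a + h, fun N hN A => ?_⟩
  obtain ⟨τ, d, hA⟩ := exists_isAdversarial (n := m + 1 + 1) hhB hN A
  have hS := hA.isSchedule hN
  refine le_iSup₂_of_le τ hS.hasFiniteDuration ?_
  have hopt := hS.le_opt (by omega) hHB hB1 hBl
  have hval := hA.value_le hN (by omega) hBu
  rw [Nat.add_sub_cancel] at hopt hval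
  have hpos : (0 : ℝ) < a + H :=
    lt_of_le_of_lt (mul_nonneg hc0 (by positivity)) hgain
  have hopt0 : opt τ ≠ 0 := by
    refine ne_of_gt (lt_of_lt_of_le ?_ hopt)
    have : 0 < a + H := by exact_mod_cast hpos
    exact_mod_cast Nat.mul_pos (Nat.succ_pos m) this
  rw [ENNReal.le_div_iff_mul_le (Or.inr hopt0)
    (Or.inl (ne_top_of_le_ne_top ENNReal.coe_ne_top hval))]
  refine le_trans ?_ hopt
  refine (mul_le_mul_right hval _).trans ?_
  rw [ENNReal.coe_natCast, ← ENNReal.ofReal_natCast, ← ENNReal.ofReal_natCast,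
    ← ENNReal.ofReal_mul hc0]
  refine ENNReal.ofReal_le_ofReal ?_
  push_cast
  nlinarith

end SharedMemorySwitch

open SharedMemorySwitch in
theorem mainTheorem2 :
    (∀ a h n B N : ℕ, B = a * h + h * (h + 1) / 2 → n + a + h ≤ N → ∀ A : OnlineAlgorithm B N,
      (∃ (τ : Instance B N) (d : ℕ → ℕ), IsAdversarial A a h n τ d) ∧
      ∀ (τ : Instance B N) (d : ℕ → ℕ), IsAdversarial A a h n τ d →
        A.value τ ≤ (lqd B N).value τ ∧
        ∀ t < n, ∀ i : Fin N, (i : ℕ) = d t →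
          ((lqd B N).run τ t i : ℝ) =
            ((B : ℝ) - ∑ j with ((j : Fin N) : ℕ) ∉ activeQueues a h d t,
              ((lqd B N).run τ t j : ℝ)) / ((a : ℝ) + 1)) ∧
    (∀ c : ℝ, c < √2 → ∃ B₀ : ℕ, ∀ B ≥ B₀, ∃ N₀ : ℕ, ∀ N ≥ N₀, ∀ A : OnlineAlgorithm B N,
      ENNReal.ofReal c ≤ A.competitiveRatio) ∧
    (∀ A : (B N : ℕ) → OnlineAlgorithm B N,
      ENNReal.ofReal (√2) ≤ ⨆ (B : ℕ) (N : ℕ), (A B N).competitiveRatio) := by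
  refine ⟨fun a h n B N hB hN A => ⟨?_, fun τ d hA => ⟨hA.value_le_lqd hN hB,
    fun t ht i hi => hA.lqd_dying hN hB ht hi⟩⟩, fun c hc => le_competitiveRatio hc, fun A => ?_⟩
  · refine exists_isAdversarial ?_ hN A
    have := half_mul_pred_add h
    omega
  · refine le_of_forall_lt fun x hx => ?_
    obtain ⟨y, hxy, hy⟩ := exists_between hx
    have hy' : y.toReal < √2 := by
      rwa [← ENNReal.ofReal_lt_ofReal_iff (by positivity), ENNReal.ofReal_toReal hy.ne_top]
    obtain ⟨B, hB⟩ := le_competitiveRatio hy'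
    obtain ⟨N, hN⟩ := hB B le_rfl
    have := hN N le_rfl (A B N)
    rw [ENNReal.ofReal_toReal hy.ne_top] at this
    exact hxy.trans_le (this.trans (le_iSup₂ (f := fun B N => (A B N).competitiveRatio) B N))
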